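/- Let $\mathbb{R}_+^n$ be the set of all $x\in\mathbb{R}^n$ with strictly positive coordinates. For $0<p\le 1$, a set $K\subset\mathbb{R}_+^n$ is called $p$-convex if $\{(x_1^p,\dots,x_n^p) : (x_1,\dots,x_n)\in K\}$ is a convex set. **Corollary 1.2.** Let $n\ge 1$ and $\ell>1$ be integers, and let $K\subset\mathbb{R}_+^n$ be a $(1/\ell)$-convex set with non-empty interior. Then for every locally Lipschitz, integrable function $f:K\to\mathbb{R}$ with $\int_K f\,dx=0$, $$\int_K f^2\,dx\;\le\;\frac{\ell^2}{\ell-1}\,\sum_{i=1}^n\int_K x_i^2\,\bigl|\partial_i f(x)\bigr|^2\,dx .$$ Here the integrals are with respect to Lebesgue measure, $\partial_i f=\partial f/\partial x_i$ is the partial derivative with respect to the $i$-th variable (it exists at almost every point of $K$), and both sides are understood in $[0,\infty]$; in particular, if the right-hand side is finite, then $f\in L^2(K)$. -/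

import Mathlib

open MeasureTheory

/-- The orthant of all points of `ℝⁿ` whose coordinates are (strictly) positive. -/
def posOrthant (n : ℕ) : Set (Fin n → ℝ) := {x | ∀ i, 0 < x i}

/-- A set `K` of points with positive coordinates is `p`-convex when
`{(x₁ ^ p, …, xₙ ^ p) ; x ∈ K}` is a convex set. -/
def IsPConvex {n : ℕ} (p : ℝ) (K : Set (Fin n → ℝ)) : Prop :=
  K ⊆ posOrthant n ∧ Convex ℝ ((fun (x : Fin n → ℝ) (i : Fin n) => x i ^ p) '' K)

/-- The partial derivative of `f` at `x` with respect to the `i`-th variable. -/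
noncomputable def partialDeriv {n : ℕ} (i : Fin n) (f : (Fin n → ℝ) → ℝ) (x : Fin n → ℝ) : ℝ :=
  lineDeriv ℝ f x (Pi.single i 1)

/-!
For a convex set with a weight `ρ` that is strictly log-concave, apply the Prékopa–Leindler
inequality to `ρ * exp (ε * g)`, `ρ * exp (-ε * g)` and `ρ` times the exponential of the supremal
penalized difference quotient of `g`. As `ε → 0`, the supremum becomes the Legendre transform of
the Hessian of `-log ρ`, evaluated at the gradient of `g`, and comparing the terms of order `ε ^ 2`
gives the Brascamp–Lieb variance inequality. The substitution `x = φ y`, `x i = y i ^ ℓ`,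
turns `K` into a convex set carrying the weight `∏ i, ℓ * y i ^ (ℓ - 1)`. Its negative logarithm
has Hessian `diag ((ℓ - 1) / y i ^ 2)`, and `(y i * ∂ᵢ (f ∘ φ)) ^ 2 / (ℓ - 1)` is
`ℓ ^ 2 / (ℓ - 1) * (x i * ∂ᵢ f) ^ 2`.
-/

open Filter Topology ProbabilityTheory
open scoped ENNReal Pointwise

/-! ### The Prékopa–Leindler inequality -/

theorem volume_add_volume_le_volume_add_of_isCompact {A B : Set ℝ} (hA : IsCompact A)
    (hB : IsCompact B) (hA₀ : A.Nonempty) (hB₀ : B.Nonempty) :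
    volume A + volume B ≤ volume (A + B) := by
  obtain ⟨a, haA, ha⟩ := hA.exists_isGreatest hA₀
  obtain ⟨b, hbB, hb⟩ := hB.exists_isLeast hB₀
  have hdisj : AEDisjoint volume (b +ᵥ A) (a +ᵥ B) := by
    refine measure_mono_null (t := {a + b}) ?_ (by simp)
    rintro _ ⟨⟨x, hx, rfl⟩, ⟨y, hy, hxy⟩⟩
    have := ha hx
    have := hb hy
    simp only [vadd_eq_add, Set.mem_singleton_iff] at hxy ⊢
    linarith
  calc volume A + volume B = volume (b +ᵥ A) + volume (a +ᵥ B) := by simp only [measure_vadd]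
    _ = volume ((b +ᵥ A) ∪ (a +ᵥ B)) :=
        (measure_union₀ (hB.measurableSet.const_vadd a).nullMeasurableSet hdisj).symm
    _ ≤ volume (A + B) := measure_mono <| Set.union_subset
        (by rintro _ ⟨x, hx, rfl⟩; exact ⟨x, hx, b, hbB, add_comm _ _⟩)
        (by rintro _ ⟨y, hy, rfl⟩; exact ⟨a, haA, y, hy, rfl⟩)

theorem volume_add_volume_le_volume_add {A B : Set ℝ} (hA : MeasurableSet A)
    (hB : MeasurableSet B) (hA₀ : A.Nonempty) (hB₀ : B.Nonempty) :
    volume A + volume B ≤ volume (A + B) := by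
  obtain ⟨a, ha⟩ := hA₀
  obtain ⟨b, hb⟩ := hB₀
  have hcompact : ∀ K ⊆ A, IsCompact K → ∀ L ⊆ B, IsCompact L →
      volume K + volume L ≤ volume (A + B) := fun K hKA hK L hLB hL =>
    calc volume K + volume L ≤ volume (insert a K) + volume (insert b L) := by
          gcongr <;> exact Set.subset_insert _ _
      _ ≤ volume (insert a K + insert b L) :=
          volume_add_volume_le_volume_add_of_isCompact (hK.insert a) (hL.insert b)
            (Set.insert_nonempty _ _) (Set.insert_nonempty _ _)
      _ ≤ volume (A + B) := measure_mono <|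
          Set.add_subset_add (Set.insert_subset ha hKA) (Set.insert_subset hb hLB)
  rw [hA.measure_eq_iSup_isCompact, hB.measure_eq_iSup_isCompact]
  simp only [iSup_and']
  rw [ENNReal.biSup_add' ⟨∅, by simp⟩]
  refine iSup₂_le fun K hK => ?_
  rw [ENNReal.add_biSup' ⟨∅, by simp⟩]
  exact iSup₂_le fun L hL => hcompact K hK.1 hK.2 L hL.1 hL.2

theorem lintegral_eq_setLIntegral_Ioo_meas_lt {α : Type*} [MeasurableSpace α] {μ : Measure α}
    {u : α → ℝ≥0∞} (hu : Measurable u) (hu₁ : ∀ x, u x ≤ 1) :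
    ∫⁻ x, u x ∂μ = ∫⁻ t in Set.Ioo (0 : ℝ) 1, μ {x | ENNReal.ofReal t < u x} := by
  have hfin : ∀ x, u x ≠ ⊤ := fun x => ne_top_of_le_ne_top ENNReal.one_ne_top (hu₁ x)
  have hvanish : ∫⁻ t in Set.Ici (1 : ℝ), μ {x | t < (u x).toReal} = 0 := by
    refine (setLIntegral_congr_fun (g := 0) measurableSet_Ici fun t ht => ?_).trans (by simp)
    have hempty : {x | t < (u x).toReal} = ∅ := Set.eq_empty_of_forall_notMem fun x hx =>
      (lt_of_le_of_lt ht hx).not_ge (ENNReal.toReal_mono ENNReal.one_ne_top (hu₁ x))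
    simp [hempty]
  calc ∫⁻ x, u x ∂μ = ∫⁻ x, ENNReal.ofReal (u x).toReal ∂μ :=
        lintegral_congr fun x => (ENNReal.ofReal_toReal (hfin x)).symm
    _ = ∫⁻ t in Set.Ioi (0 : ℝ), μ {x | t < (u x).toReal} :=
        lintegral_eq_lintegral_meas_lt _ (.of_forall fun _ => ENNReal.toReal_nonneg)
          hu.ennreal_toReal.aemeasurable
    _ = ∫⁻ t in Set.Ioo (0 : ℝ) 1, μ {x | t < (u x).toReal} := by
        rw [← Set.Ioo_union_Ici_eq_Ioi one_pos, lintegral_union measurableSet_Ici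
          (Set.disjoint_left.2 fun t ht ht' => ht.2.not_ge ht'), hvanish, add_zero]
    _ = _ := setLIntegral_congr_fun measurableSet_Ioo fun t ht => by
        simp only [ENNReal.ofReal_lt_iff_lt_toReal ht.1.le (hfin _)]

theorem prekopaLeindler_real_of_iSup_eq_one {u v w : ℝ → ℝ≥0∞} (hu : Measurable u)
    (hv : Measurable v) (hw : Measurable w) (hu₁ : ⨆ x, u x = 1) (hv₁ : ⨆ x, v x = 1)
    (h : ∀ x y, u x * v y ≤ w ((1 / 2 : ℝ) • (x + y)) ^ 2) :
    (∫⁻ x, u x) + ∫⁻ x, v x ≤ 2 * ∫⁻ x, w x := by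
  -- As both suprema equal `1`, the superlevel sets of `u` and `v` are nonempty for the same `t`,
  -- so the one-dimensional Brunn–Minkowski inequality applies at every level.
  have hlevel : ∀ t ∈ Set.Ioo (0 : ℝ) 1,
      volume {x | ENNReal.ofReal t < u x} + volume {x | ENNReal.ofReal t < v x} ≤
        2 * volume {x | ENNReal.ofReal t < min (w x) 1} := fun t ht => by
    have ht₁ : ENNReal.ofReal t < 1 := ENNReal.ofReal_lt_one.2 ht.2
    have hne {f : ℝ → ℝ≥0∞} (hf : ⨆ x, f x = 1) : ∃ x, ENNReal.ofReal t < f x :=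
      lt_iSup_iff.1 (by rwa [hf])
    have hsum : {x | ENNReal.ofReal t < u x} + {x | ENNReal.ofReal t < v x} ⊆
        (2 : ℝ) • {x | ENNReal.ofReal t < min (w x) 1} := by
      rintro _ ⟨x, hx, y, hy, rfl⟩
      refine (Set.mem_smul_set_iff_inv_smul_mem₀ two_ne_zero _ _).2 (lt_min ?_ ht₁)
      have hlt : ENNReal.ofReal t ^ 2 < w ((1 / 2 : ℝ) • (x + y)) ^ 2 := by
        rw [pow_two]
        exact (ENNReal.mul_lt_mul hx hy).trans_le (h x y)
      simpa only [one_div] using lt_of_pow_lt_pow_left' 2 hlt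
    calc _ ≤ _ := volume_add_volume_le_volume_add (measurableSet_lt measurable_const hu)
          (measurableSet_lt measurable_const hv) (hne hu₁) (hne hv₁)
      _ ≤ _ := measure_mono hsum
      _ = _ := by rw [Measure.addHaar_smul]; simp
  have hanti : Antitone fun t : ℝ => volume {x | ENNReal.ofReal t < u x} := fun s t hst =>
    measure_mono fun x hx => (ENNReal.ofReal_le_ofReal hst).trans_lt hx
  calc (∫⁻ x, u x) + ∫⁻ x, v x
      = ∫⁻ t in Set.Ioo (0 : ℝ) 1,
          (volume {x | ENNReal.ofReal t < u x} + volume {x | ENNReal.ofReal t < v x}) := by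
        rw [lintegral_eq_setLIntegral_Ioo_meas_lt hu fun x => hu₁ ▸ le_iSup u x,
          lintegral_eq_setLIntegral_Ioo_meas_lt hv fun x => hv₁ ▸ le_iSup v x,
          lintegral_add_left hanti.measurable]
    _ ≤ ∫⁻ t in Set.Ioo (0 : ℝ) 1, 2 * volume {x | ENNReal.ofReal t < min (w x) 1} :=
        setLIntegral_mono' measurableSet_Ioo hlevel
    _ = 2 * ∫⁻ x, min (w x) 1 := by
        rw [lintegral_const_mul' _ _ ENNReal.ofNat_ne_top, ← lintegral_eq_setLIntegral_Ioo_meas_lt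
          (hw.min measurable_const) fun x => min_le_right _ _]
    _ ≤ 2 * ∫⁻ x, w x := by gcongr; exact min_le_left _ _

theorem mul_le_sq_of_add_le_two_mul {a b c : ℝ≥0∞} (h : a + b ≤ 2 * c) : a * b ≤ c ^ 2 := by
  rcases eq_or_ne c ⊤ with rfl | hc
  · simp
  obtain ⟨ha, hb⟩ := ENNReal.add_ne_top.1
    (ne_top_of_le_ne_top (ENNReal.mul_ne_top ENNReal.ofNat_ne_top hc) h)
  lift a to NNReal using ha
  lift b to NNReal using hb
  lift c to NNReal using hc
  norm_cast at h ⊢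
  refine le_of_mul_le_mul_left (a := 4) ?_ four_pos
  calc 4 * (a * b) = 4 * a * b := (mul_assoc _ _ _).symm
    _ ≤ (a + b) ^ 2 := four_mul_le_sq_add a b
    _ ≤ (2 * c) ^ 2 := by gcongr
    _ = 4 * c ^ 2 := by ring

theorem prekopaLeindler_real_of_iSup_ne_top {u v w : ℝ → ℝ≥0∞} (hu : Measurable u)
    (hv : Measurable v) (hw : Measurable w) (hu_top : ⨆ x, u x ≠ ⊤) (hv_top : ⨆ x, v x ≠ ⊤)
    (h : ∀ x y, u x * v y ≤ w ((1 / 2 : ℝ) • (x + y)) ^ 2) :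
    (∫⁻ x, u x) * ∫⁻ x, v x ≤ (∫⁻ x, w x) ^ 2 := by
  set a := ⨆ x, u x with ha
  set b := ⨆ x, v x with hb
  rcases eq_or_ne a 0 with ha₀ | ha₀
  · simp [ENNReal.iSup_eq_zero.1 (ha.symm.trans ha₀)]
  rcases eq_or_ne b 0 with hb₀ | hb₀
  · simp [ENNReal.iSup_eq_zero.1 (hb.symm.trans hb₀)]
  obtain ⟨c, hc⟩ : ∃ c : ℝ≥0∞, c ^ 2 = a * b :=
    ⟨(a * b) ^ (2⁻¹ : ℝ), by exact_mod_cast ENNReal.rpow_inv_natCast_pow two_ne_zero (a * b)⟩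
  have hinv : (c⁻¹) ^ 2 = a⁻¹ * b⁻¹ := by
    rw [← ENNReal.inv_pow, hc, ENNReal.mul_inv (.inl ha₀) (.inl hu_top)]
  have hnormalized := mul_le_sq_of_add_le_two_mul <| prekopaLeindler_real_of_iSup_eq_one
    (hu.const_mul a⁻¹) (hv.const_mul b⁻¹) (hw.const_mul c⁻¹)
    (by rw [← ENNReal.mul_iSup, ← ha, ENNReal.inv_mul_cancel ha₀ hu_top])
    (by rw [← ENNReal.mul_iSup, ← hb, ENNReal.inv_mul_cancel hb₀ hv_top])
    fun x y => by
      rw [mul_pow, hinv, mul_mul_mul_comm]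
      gcongr
      exact h x y
  rw [lintegral_const_mul _ hu, lintegral_const_mul _ hv, lintegral_const_mul _ hw,
    mul_mul_mul_comm, mul_pow, hinv] at hnormalized
  exact (ENNReal.mul_le_mul_iff_right
    (mul_ne_zero (ENNReal.inv_ne_zero.2 hu_top) (ENNReal.inv_ne_zero.2 hv_top))
    (ENNReal.mul_ne_top (ENNReal.inv_ne_top.2 ha₀) (ENNReal.inv_ne_top.2 hb₀))).1 hnormalized

theorem tendsto_lintegral_min_natCast {α : Type*} [MeasurableSpace α] {μ : Measure α}
    {u : α → ℝ≥0∞} (hu : Measurable u) :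
    Tendsto (fun N : ℕ => ∫⁻ x, min (u x) N ∂μ) atTop (𝓝 (∫⁻ x, u x ∂μ)) := by
  refine lintegral_tendsto_of_tendsto_of_monotone
    (fun N => (hu.min measurable_const).aemeasurable)
    (.of_forall fun x N M hNM => min_le_min_left _ (by exact_mod_cast hNM))
    (.of_forall fun x => ?_)
  simpa only [min_top_right] using tendsto_const_nhds.min ENNReal.tendsto_nat_nhds_top

theorem prekopaLeindler_real {u v w : ℝ → ℝ≥0∞} (hu : Measurable u) (hv : Measurable v)
    (hw : Measurable w) (h : ∀ x y, u x * v y ≤ w ((1 / 2 : ℝ) • (x + y)) ^ 2) :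
    (∫⁻ x, u x) * ∫⁻ x, v x ≤ (∫⁻ x, w x) ^ 2 := by
  rcases eq_or_ne (∫⁻ x, u x) 0 with hu₀ | hu₀
  · simp [hu₀]
  rcases eq_or_ne (∫⁻ x, v x) 0 with hv₀ | hv₀
  · simp [hv₀]
  have hbdd : ∀ (f : ℝ → ℝ≥0∞) (N : ℕ), ⨆ x, min (f x) N ≠ ⊤ := fun f N =>
    ne_top_of_le_ne_top (ENNReal.natCast_ne_top N) (iSup_le fun x => min_le_right _ _)
  exact le_of_tendsto (ENNReal.Tendsto.mul (tendsto_lintegral_min_natCast hu) (.inl hu₀)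
    (tendsto_lintegral_min_natCast hv) (.inl hv₀)) <| .of_forall fun N =>
    prekopaLeindler_real_of_iSup_ne_top (hu.min measurable_const) (hv.min measurable_const) hw
      (hbdd u N) (hbdd v N) fun x y =>
      (mul_le_mul' (min_le_left _ _) (min_le_left _ _)).trans (h x y)

theorem lintegral_eq_lintegral_lintegral_finCons {n : ℕ} {u : (Fin (n + 1) → ℝ) → ℝ≥0∞}
    (hu : Measurable u) : ∫⁻ x, u x = ∫⁻ s : ℝ, ∫⁻ y : Fin n → ℝ, u (Fin.cons s y) := by
  have e := (volume_preserving_piFinSuccAbove (fun _ : Fin (n + 1) => ℝ) 0).symm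
  rw [← e.lintegral_comp hu, Measure.volume_eq_prod, lintegral_prod]
  · simp [MeasurableEquiv.piFinSuccAbove, Fin.insertNthEquiv]
  · exact (hu.comp e.measurable).aemeasurable

theorem prekopaLeindler {n : ℕ} {u v w : (Fin n → ℝ) → ℝ≥0∞} (hu : Measurable u)
    (hv : Measurable v) (hw : Measurable w)
    (h : ∀ x y, u x * v y ≤ w ((1 / 2 : ℝ) • (x + y)) ^ 2) :
    (∫⁻ x, u x) * ∫⁻ x, v x ≤ (∫⁻ x, w x) ^ 2 := by
  induction n with
  | zero => simpa [Measure.volume_pi_eq_dirac 0] using h 0 0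
  | succ n ih =>
    have hcons : Measurable fun p : ℝ × (Fin n → ℝ) => (Fin.cons p.1 p.2 : Fin (n + 1) → ℝ) :=
      measurable_pi_iff.2 <| Fin.cases (by simpa using measurable_fst) fun j => by
        simp only [Fin.cons_succ]
        fun_prop
    have hslice {f : (Fin (n + 1) → ℝ) → ℝ≥0∞} (hf : Measurable f) (s : ℝ) :
        Measurable fun y => f (Fin.cons s y) := (hf.comp hcons).comp measurable_prodMk_left
    rw [lintegral_eq_lintegral_lintegral_finCons hu, lintegral_eq_lintegral_lintegral_finCons hv,
      lintegral_eq_lintegral_lintegral_finCons hw]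
    refine prekopaLeindler_real (hu.comp hcons).lintegral_prod_right'
      (hv.comp hcons).lintegral_prod_right' (hw.comp hcons).lintegral_prod_right' fun s t =>
      ih (hslice hu s) (hslice hv t) (hslice hw _) fun x y => ?_
    convert h (Fin.cons s x) (Fin.cons t y) using 3
    ext i
    cases i using Fin.cases <;> simp [mul_add]

theorem one_add_sq_div_two_le_cosh (x : ℝ) : 1 + x ^ 2 / 2 ≤ Real.cosh x := by
  have hsinh : (x / 2) ^ 2 ≤ Real.sinh (x / 2) ^ 2 := by
    rw [sq_le_sq, Real.abs_sinh]
    exact Real.self_le_sinh_iff.2 (abs_nonneg _)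
  calc 1 + x ^ 2 / 2 ≤ Real.sinh (x / 2) ^ 2 + 1 + Real.sinh (x / 2) ^ 2 := by linarith
    _ = Real.cosh x := by rw [← Real.cosh_sq, ← Real.cosh_two_mul, mul_div_cancel₀ x two_ne_zero]

theorem integrable_sub_sq_prod {α : Type*} [MeasurableSpace α] {μ : Measure α}
    [IsFiniteMeasure μ] {g : α → ℝ} (hg : MemLp g 2 μ) :
    Integrable (fun p : α × α => (g p.1 - g p.2) ^ 2) (μ.prod μ) :=
  ((hg.comp_fst μ).sub (hg.comp_snd μ)).integrable_sq

theorem integral_sub_sq_prod {α : Type*} [MeasurableSpace α] {μ : Measure α}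
    [IsFiniteMeasure μ] {g : α → ℝ} (hg : MemLp g 2 μ) :
    ∫ p, (g p.1 - g p.2) ^ 2 ∂μ.prod μ =
      2 * (μ.real Set.univ * ∫ x, g x ^ 2 ∂μ - (∫ x, g x ∂μ) ^ 2) := by
  have hg₁ : Integrable g μ := hg.integrable one_le_two
  have hsq₁ : Integrable (fun p : α × α => g p.1 ^ 2) (μ.prod μ) := hg.integrable_sq.comp_fst μ
  have hsq₂ : Integrable (fun p : α × α => g p.2 ^ 2) (μ.prod μ) := hg.integrable_sq.comp_snd μ
  have hcross : Integrable (fun p : α × α => 2 * (g p.1 * g p.2)) (μ.prod μ) :=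
    (hg₁.mul_prod hg₁).const_mul 2
  calc ∫ p, (g p.1 - g p.2) ^ 2 ∂μ.prod μ
      = ∫ p, (g p.1 ^ 2 + g p.2 ^ 2 - 2 * (g p.1 * g p.2)) ∂μ.prod μ := by
        congr 1 with p
        ring
    _ = ∫ p, g p.1 ^ 2 ∂μ.prod μ + ∫ p, g p.2 ^ 2 ∂μ.prod μ -
          2 * ∫ p, g p.1 * g p.2 ∂μ.prod μ := by
        rw [integral_sub (by exact hsq₁.add hsq₂) hcross, integral_add hsq₁ hsq₂,
          integral_const_mul]
    _ = 2 * (μ.real Set.univ * ∫ x, g x ^ 2 ∂μ - (∫ x, g x ∂μ) ^ 2) := by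
        rw [integral_fun_fst (fun x => g x ^ 2), integral_fun_snd (fun x => g x ^ 2),
          integral_prod_mul]
        simp only [smul_eq_mul]
        ring

theorem sq_add_sq_mul_le_mgf_mul_mgf {α : Type*} [MeasurableSpace α] {μ : Measure α}
    [IsFiniteMeasure μ] {g : α → ℝ} (hg : MemLp g 2 μ) {t : ℝ}
    (hpos : Integrable (fun x => Real.exp (t * g x)) μ)
    (hneg : Integrable (fun x => Real.exp (-t * g x)) μ) :
    μ.real Set.univ ^ 2 + t ^ 2 * (μ.real Set.univ * ∫ x, g x ^ 2 ∂μ - (∫ x, g x ∂μ) ^ 2) ≤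
      mgf g μ t * mgf g μ (-t) := by
  have hexp₁ := hpos.mul_prod hneg
  have hexp₂ := hneg.mul_prod hpos
  calc _ = ∫ p, (1 + t ^ 2 / 2 * (g p.1 - g p.2) ^ 2) ∂μ.prod μ := by
        rw [integral_add (integrable_const _) ((integrable_sub_sq_prod hg).const_mul _),
          integral_const_mul, integral_sub_sq_prod hg, integral_const, ← Set.univ_prod_univ,
          measureReal_prod_prod, smul_eq_mul]
        ring
    _ ≤ ∫ p, (Real.exp (t * g p.1) * Real.exp (-t * g p.2) +
          Real.exp (-t * g p.1) * Real.exp (t * g p.2)) / 2 ∂μ.prod μ := by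
        refine integral_mono ((integrable_const _).add ((integrable_sub_sq_prod hg).const_mul _))
          ((hexp₁.add hexp₂).div_const 2) fun p => ?_
        have hcosh := one_add_sq_div_two_le_cosh (t * (g p.1 - g p.2))
        rw [Real.cosh_eq] at hcosh
        simp only [← Real.exp_add]
        ring_nf at hcosh ⊢
        exact hcosh
    _ = mgf g μ t * mgf g μ (-t) := by
        rw [integral_div, integral_add hexp₁ hexp₂,
          integral_prod_mul (fun x => Real.exp (t * g x)) fun x => Real.exp (-t * g x),
          integral_prod_mul (fun x => Real.exp (-t * g x)) fun x => Real.exp (t * g x), mgf, mgf]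
        ring

theorem le_of_eventually_sq_add_sq_mul_le {M V r : ℝ} {η : ℝ → ℝ}
    (hη : Tendsto η (𝓝[>] 0) (𝓝 r))
    (h : ∀ᶠ ε in 𝓝[>] (0 : ℝ), M ^ 2 + ε ^ 2 * V ≤ (M + ε ^ 2 / 2 * η ε) ^ 2) : V ≤ M * r := by
  have hsq : Tendsto (fun ε : ℝ => ε ^ 2) (𝓝[>] 0) (𝓝 0) :=
    ((continuous_pow 2).tendsto' 0 0 (by simp)).mono_left nhdsWithin_le_nhds
  have hlim : Tendsto (fun ε => M * η ε + ε ^ 2 * (η ε ^ 2 / 4)) (𝓝[>] 0) (𝓝 (M * r)) := by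
    simpa using (hη.const_mul M).add (hsq.mul ((hη.pow 2).div_const 4))
  refine ge_of_tendsto hlim ?_
  filter_upwards [h, self_mem_nhdsWithin] with ε hε hpos
  refine le_of_mul_le_mul_left ?_ (pow_pos (Set.mem_Ioi.1 hpos) 2)
  linarith

/-! ### Weighted Brascamp–Lieb inequality -/

/-- Midpoint form of the Hessian bound `Hess (-log ρ) z ≥ diag (s z i)⁻²` for a positive
continuous density `ρ` on `U`: the numbers `s z i` are the length scales on which `ρ` is strictly
log-concave in the coordinate directions. Stated without derivatives of `ρ`. -/
structure HasLogConcavityScale {n : ℕ} (ρ : (Fin n → ℝ) → ℝ) (s : (Fin n → ℝ) → Fin n → ℝ)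
    (U : Set (Fin n → ℝ)) : Prop where
  pos : ∀ z ∈ U, 0 < ρ z
  continuousOn : ContinuousOn ρ U
  scale_pos : ∀ z ∈ U, ∀ i, 0 < s z i
  continuousOn_scale : ContinuousOn s U
  mul_le : ∀ z h, z + h ∈ U → z - h ∈ U →
    ρ (z + h) * ρ (z - h) ≤ ρ z ^ 2 * Real.exp (-∑ i, (h i / s z i) ^ 2)

theorem HasLogConcavityScale.mono {n : ℕ} {ρ : (Fin n → ℝ) → ℝ} {s : (Fin n → ℝ) → Fin n → ℝ}
    {U V : Set (Fin n → ℝ)} (hρ : HasLogConcavityScale ρ s V) (hUV : U ⊆ V) :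
    HasLogConcavityScale ρ s U where
  pos z hz := hρ.pos z (hUV hz)
  continuousOn := hρ.continuousOn.mono hUV
  scale_pos z hz := hρ.scale_pos z (hUV hz)
  continuousOn_scale := hρ.continuousOn_scale.mono hUV
  mul_le z h h₁ h₂ := hρ.mul_le z h (hUV h₁) (hUV h₂)

/-- The points of `U` from which one may step by `± ε • k` inside `U`. -/
def stepSet {E : Type*} [AddCommGroup E] [Module ℝ E] (U : Set E) (ε : ℝ) (k : E) : Set E :=
  {z | z + ε • k ∈ U ∧ z - ε • k ∈ U}

/-- The symmetric difference quotient of `g` in the direction `k` at step `ε`, penalized by the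
Hessian `∑ i, (k i / s z i) ^ 2` of a potential with length scales `s`. -/
noncomputable def penalizedQuotient {n : ℕ} (s : (Fin n → ℝ) → Fin n → ℝ)
    (g : (Fin n → ℝ) → ℝ) (ε : ℝ) (k z : Fin n → ℝ) : ℝ :=
  (g (z + ε • k) - g (z - ε • k)) / ε - ∑ i, (k i / s z i) ^ 2

/-- The supremum of the positive part of the penalized quotient over all directions `k` that are
admissible at `z`. As `ε → 0` it tends to the Legendre transform of the Hessian, `scaledGradSq`. -/
noncomputable def supPenalizedQuotient {n : ℕ} (s : (Fin n → ℝ) → Fin n → ℝ)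
    (U : Set (Fin n → ℝ)) (g : (Fin n → ℝ) → ℝ) (ε : ℝ) (z : Fin n → ℝ) : ℝ≥0∞ :=
  ⨆ k, (stepSet U ε k).indicator (fun z => ENNReal.ofReal (penalizedQuotient s g ε k z)) z

/-- The squared norm of the gradient of `g` in the metric dual to the Hessian `diag (s z i)⁻²`. -/
noncomputable def scaledGradSq {n : ℕ} (s : (Fin n → ℝ) → Fin n → ℝ) (g : (Fin n → ℝ) → ℝ)
    (z : Fin n → ℝ) : ℝ :=
  ∑ i, (s z i * partialDeriv i g z) ^ 2

theorem isOpen_stepSet {E : Type*} [NormedAddCommGroup E] [NormedSpace ℝ E] {U : Set E}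
    (hU : IsOpen U) (ε : ℝ) (k : E) : IsOpen (stepSet U ε k) :=
  (hU.preimage (by fun_prop : Continuous fun z => z + ε • k)).inter
    (hU.preimage (by fun_prop : Continuous fun z => z - ε • k))

theorem stepSet_subset {E : Type*} [AddCommGroup E] [Module ℝ E] {U : Set E} (hU : Convex ℝ U)
    (ε : ℝ) (k : E) : stepSet U ε k ⊆ U := fun z hz => by
  convert hU hz.1 hz.2 one_half_pos.le one_half_pos.le (add_halves 1) using 1
  module

theorem lowerSemicontinuous_indicator_of_continuousOn {X : Type*} [TopologicalSpace X]
    {O : Set X} (hO : IsOpen O) {F : X → ℝ≥0∞} (hF : ContinuousOn F O) :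
    LowerSemicontinuous (O.indicator F) := by
  refine lowerSemicontinuous_iff_isOpen_preimage.2 fun a => ?_
  have hpre : O.indicator F ⁻¹' Set.Ioi a = O ∩ F ⁻¹' Set.Ioi a := by
    ext x
    by_cases hx : x ∈ O <;> simp [hx]
  exact hpre ▸ hF.isOpen_inter_preimage hO isOpen_Ioi

section SupPenalizedQuotient

variable {n : ℕ} {s : (Fin n → ℝ) → Fin n → ℝ} {U : Set (Fin n → ℝ)} {g : (Fin n → ℝ) → ℝ}
  {z k : Fin n → ℝ} {ε R : ℝ} {L : NNReal}

theorem measurable_supPenalizedQuotient (hU : IsOpen U) (hconv : Convex ℝ U)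
    (hs : ContinuousOn s U) (hs₀ : ∀ z ∈ U, ∀ i, 0 < s z i) (hg : ContinuousOn g U) (ε : ℝ) :
    Measurable (supPenalizedQuotient s U g ε) := by
  refine (lowerSemicontinuous_iSup fun k => lowerSemicontinuous_indicator_of_continuousOn
    (isOpen_stepSet hU ε k) (ENNReal.continuous_ofReal.comp_continuousOn ?_)).measurable
  have hsub := stepSet_subset hconv ε k
  have hquot : ContinuousOn (fun z => (g (z + ε • k) - g (z - ε • k)) / ε) (stepSet U ε k) :=
    ((hg.comp (by fun_prop) fun z hz => hz.1).sub
      (hg.comp (by fun_prop) fun z hz => hz.2)).div_const ε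
  exact hquot.sub <| continuousOn_finsetSum _ fun i _ => (continuousOn_const.div
    (continuousOn_pi.1 (hs.mono hsub) i) fun z hz => (hs₀ z (hsub hz) i).ne').pow 2

theorem norm_le_mul_sqrt_sum_div_sq {ι : Type*} [Fintype ι] {r : ι → ℝ} (hr : ∀ i, 0 < r i)
    (hR : 0 ≤ R) (hrR : ∀ i, r i ≤ R) (k : ι → ℝ) : ‖k‖ ≤ R * √(∑ i, (k i / r i) ^ 2) := by
  refine (pi_norm_le_iff_of_nonneg (by positivity)).2 fun i => ?_
  have hi : |k i / r i| ≤ √(∑ i, (k i / r i) ^ 2) := Real.abs_le_sqrt <|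
    Finset.single_le_sum (f := fun i => (k i / r i) ^ 2) (fun j _ => sq_nonneg _)
      (Finset.mem_univ i)
  calc ‖k i‖ = r i * |k i / r i| := by
        rw [abs_div, abs_of_pos (hr i), mul_div_cancel₀ _ (hr i).ne', Real.norm_eq_abs]
    _ ≤ R * √(∑ i, (k i / r i) ^ 2) := by
        gcongr
        exact hrR i

theorem penalizedQuotient_le_mul_sqrt_sub (hg : LipschitzOnWith L g U) (hε : 0 < ε) (hR : 0 ≤ R)
    (hs : ∀ i, 0 < s z i) (hsR : ∀ i, s z i ≤ R) (hk : z ∈ stepSet U ε k) :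
    penalizedQuotient s g ε k z ≤
      2 * (L * R) * √(∑ i, (k i / s z i) ^ 2) - √(∑ i, (k i / s z i) ^ 2) ^ 2 := by
  rw [penalizedQuotient, Real.sq_sqrt (Finset.sum_nonneg fun i _ => sq_nonneg _)]
  gcongr
  rw [div_le_iff₀ hε]
  calc g (z + ε • k) - g (z - ε • k) ≤ L * ‖(z + ε • k) - (z - ε • k)‖ :=
        (le_abs_self _).trans (hg.norm_sub_le hk.1 hk.2)
    _ = L * (2 * ε * ‖k‖) := by
        rw [show z + ε • k - (z - ε • k) = (2 * ε) • k by module,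
          norm_smul_of_nonneg (by positivity)]
    _ ≤ L * (2 * ε * (R * √(∑ i, (k i / s z i) ^ 2))) := by
        gcongr
        exact norm_le_mul_sqrt_sum_div_sq hs hR hsR k
    _ = _ := by ring

theorem penalizedQuotient_le_sq (hg : LipschitzOnWith L g U) (hε : 0 < ε) (hR : 0 ≤ R)
    (hs : ∀ i, 0 < s z i) (hsR : ∀ i, s z i ≤ R) (hk : z ∈ stepSet U ε k) :
    penalizedQuotient s g ε k z ≤ (L * R) ^ 2 := by
  have hle := penalizedQuotient_le_mul_sqrt_sub hg hε hR hs hsR hk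
  linarith [sq_nonneg (L * R - √(∑ i, (k i / s z i) ^ 2))]

theorem supPenalizedQuotient_le {B : ℝ≥0∞} (h : ∀ k, z ∈ stepSet U ε k →
    ENNReal.ofReal (penalizedQuotient s g ε k z) ≤ B) : supPenalizedQuotient s U g ε z ≤ B :=
  iSup_le fun k => Set.indicator_apply_le (g := fun _ => B) (h k)

theorem ofReal_penalizedQuotient_le_sup (hk : z ∈ stepSet U ε k) :
    ENNReal.ofReal (penalizedQuotient s g ε k z) ≤ supPenalizedQuotient s U g ε z :=
  (Set.indicator_of_mem hk _).ge.trans <| le_iSup (fun k =>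
    (stepSet U ε k).indicator (fun z => ENNReal.ofReal (penalizedQuotient s g ε k z)) z) k

theorem eventually_abs_symmetricQuotient_sub_fderiv_le {E : Type*} [NormedAddCommGroup E]
    [NormedSpace ℝ E] {g : E → ℝ} {z : E} (hg : DifferentiableAt ℝ g z) {κ : ℝ} (hκ : 0 < κ)
    {δ : ℝ} (hδ : 0 < δ) : ∀ᶠ ε in 𝓝[>] (0 : ℝ), ∀ k, ‖k‖ ≤ κ →
      |(g (z + ε • k) - g (z - ε • k)) / ε - 2 * fderiv ℝ g z k| ≤ δ := by
  obtain ⟨r, hr, hball⟩ := Metric.eventually_nhds_iff_ball.1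
    ((hasFDerivAt_iff_isLittleO_nhds_zero.1 hg.hasFDerivAt).bound
      (div_pos hδ (mul_pos two_pos hκ)))
  filter_upwards [self_mem_nhdsWithin,
    nhdsWithin_le_nhds (eventually_lt_nhds (div_pos hr hκ))] with ε hε hεr k hk
  have hε : 0 < ε := hε
  have hnorm : ‖ε • k‖ ≤ ε * κ := by
    rw [norm_smul_of_nonneg hε.le]
    gcongr
  have hmem : ‖ε • k‖ < r := hnorm.trans_lt ((lt_div_iff₀ hκ).1 hεr)
  have hplus := hball (ε • k) (mem_ball_zero_iff.2 hmem)
  have hminus := hball (-(ε • k)) (by rwa [mem_ball_zero_iff, norm_neg])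
  rw [norm_neg, ← sub_eq_add_neg] at hminus
  have herror : δ / (2 * κ) * ‖ε • k‖ ≤ δ / 2 * ε := by
    calc δ / (2 * κ) * ‖ε • k‖ ≤ δ / (2 * κ) * (ε * κ) := by gcongr
      _ = δ / 2 * ε := by field_simp
  calc |(g (z + ε • k) - g (z - ε • k)) / ε - 2 * fderiv ℝ g z k|
      = |(g (z + ε • k) - g z - fderiv ℝ g z (ε • k)) -
          (g (z - ε • k) - g z - fderiv ℝ g z (-(ε • k)))| / ε := by
        rw [← abs_of_pos hε, ← abs_div, abs_of_pos hε, map_neg, map_smul, smul_eq_mul]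
        congr 1
        field_simp
        ring
    _ ≤ (δ / 2 * ε + δ / 2 * ε) / ε := by
        gcongr
        exact (norm_sub_le _ _).trans (add_le_add (hplus.trans herror) (hminus.trans herror))
    _ = δ := by
        field_simp
        ring

theorem fderiv_apply_eq_sum_partialDeriv (hg : DifferentiableAt ℝ g z) (k : Fin n → ℝ) :
    fderiv ℝ g z k = ∑ i, k i * partialDeriv i g z := by
  conv_lhs => rw [pi_eq_sum_univ' k]
  simp only [map_sum, map_smul, smul_eq_mul, partialDeriv, hg.lineDeriv_eq_fderiv]

theorem two_mul_fderiv_sub_le_scaledGradSq (hg : DifferentiableAt ℝ g z) (hs : ∀ i, 0 < s z i)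
    (k : Fin n → ℝ) :
    2 * fderiv ℝ g z k - ∑ i, (k i / s z i) ^ 2 ≤ scaledGradSq s g z := by
  rw [fderiv_apply_eq_sum_partialDeriv hg, Finset.mul_sum, ← Finset.sum_sub_distrib]
  refine Finset.sum_le_sum fun i _ => ?_
  have hki : k i * partialDeriv i g z = k i / s z i * (s z i * partialDeriv i g z) := by
    rw [← mul_assoc, div_mul_cancel₀ _ (hs i).ne']
  rw [hki]
  linarith [sq_nonneg (k i / s z i - s z i * partialDeriv i g z)]

theorem two_mul_fderiv_sub_eq_scaledGradSq (hg : DifferentiableAt ℝ g z) (hs : ∀ i, 0 < s z i) :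
    2 * fderiv ℝ g z (fun i => s z i ^ 2 * partialDeriv i g z) -
      ∑ i, (s z i ^ 2 * partialDeriv i g z / s z i) ^ 2 = scaledGradSq s g z := by
  rw [fderiv_apply_eq_sum_partialDeriv hg, Finset.mul_sum, ← Finset.sum_sub_distrib]
  refine Finset.sum_congr rfl fun i _ => ?_
  have := (hs i).ne'
  field_simp
  ring

theorem scaledGradSq_nonneg (s : (Fin n → ℝ) → Fin n → ℝ) (g : (Fin n → ℝ) → ℝ)
    (z : Fin n → ℝ) : 0 ≤ scaledGradSq s g z :=
  Finset.sum_nonneg fun _ _ => sq_nonneg _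

theorem eventually_supPenalizedQuotient_le (hg : LipschitzOnWith L g U)
    (hd : DifferentiableAt ℝ g z) (hR : 0 ≤ R) (hs : ∀ i, 0 < s z i) (hsR : ∀ i, s z i ≤ R)
    {δ : ℝ} (hδ : 0 < δ) : ∀ᶠ ε in 𝓝[>] (0 : ℝ),
      supPenalizedQuotient s U g ε z ≤ ENNReal.ofReal (scaledGradSq s g z + δ) := by
  have hκ : 0 < R * (2 * (L * R)) + 1 := by positivity
  filter_upwards [self_mem_nhdsWithin,
    eventually_abs_symmetricQuotient_sub_fderiv_le hd hκ hδ] with ε hε hunif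
  refine supPenalizedQuotient_le fun k hk => ENNReal.ofReal_le_ofReal ?_
  have hLip := penalizedQuotient_le_mul_sqrt_sub hg hε hR hs hsR hk
  have hnorm := norm_le_mul_sqrt_sum_div_sq hs hR hsR k
  rcases le_total (√(∑ i, (k i / s z i) ^ 2)) (2 * (L * R)) with hσ | hσ
  · have hkκ : ‖k‖ ≤ R * (2 * (L * R)) + 1 := by
      linarith [mul_le_mul_of_nonneg_left hσ hR]
    have hquot := (abs_le.1 (hunif k hkκ)).2
    have hLegendre := two_mul_fderiv_sub_le_scaledGradSq hd hs k
    rw [penalizedQuotient]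
    linarith
  · have hneg := mul_le_mul_of_nonneg_right hσ (Real.sqrt_nonneg (∑ i, (k i / s z i) ^ 2))
    linarith [scaledGradSq_nonneg s g z]

theorem eventually_le_supPenalizedQuotient (hU : U ∈ 𝓝 z) (hd : DifferentiableAt ℝ g z)
    (hs : ∀ i, 0 < s z i) {δ : ℝ} (hδ : 0 < δ) : ∀ᶠ ε in 𝓝[>] (0 : ℝ),
      ENNReal.ofReal (scaledGradSq s g z - δ) ≤ supPenalizedQuotient s U g ε z := by
  -- This `k` attains the maximum in the Legendre transform of the Hessian `diag (s z i)⁻²`.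
  set k : Fin n → ℝ := fun i => s z i ^ 2 * partialDeriv i g z with hk
  have hstep : ∀ᶠ ε in 𝓝[>] (0 : ℝ), z ∈ stepSet U ε k := by
    have hplus : Tendsto (fun ε : ℝ => z + ε • k) (𝓝 0) (𝓝 z) :=
      Continuous.tendsto' (by fun_prop) _ _ (by simp)
    have hminus : Tendsto (fun ε : ℝ => z - ε • k) (𝓝 0) (𝓝 z) :=
      Continuous.tendsto' (by fun_prop) _ _ (by simp)
    exact nhdsWithin_le_nhds ((hplus.eventually hU).and (hminus.eventually hU))
  filter_upwards [hstep, eventually_abs_symmetricQuotient_sub_fderiv_le hd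
    (by positivity : 0 < ‖k‖ + 1) hδ] with ε hε hunif
  refine (ENNReal.ofReal_le_ofReal ?_).trans (ofReal_penalizedQuotient_le_sup hε)
  have hquot := (abs_le.1 (hunif k (le_add_of_nonneg_right zero_le_one))).1
  rw [← two_mul_fderiv_sub_eq_scaledGradSq hd hs, ← hk, penalizedQuotient]
  linarith

theorem tendsto_supPenalizedQuotient (hU : U ∈ 𝓝 z) (hg : LipschitzOnWith L g U)
    (hd : DifferentiableAt ℝ g z) (hR : 0 ≤ R) (hs : ∀ i, 0 < s z i) (hsR : ∀ i, s z i ≤ R) :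
    Tendsto (fun ε => supPenalizedQuotient s U g ε z) (𝓝[>] 0)
      (𝓝 (ENNReal.ofReal (scaledGradSq s g z))) := by
  have hperturb (c : ℝ) : Tendsto (fun δ => ENNReal.ofReal (scaledGradSq s g z + c * δ)) (𝓝[>] 0)
      (𝓝 (ENNReal.ofReal (scaledGradSq s g z))) :=
    tendsto_nhdsWithin_of_tendsto_nhds <| (ENNReal.continuous_ofReal.comp (by fun_prop :
      Continuous fun δ : ℝ => scaledGradSq s g z + c * δ)).tendsto' _ _ (by simp)
  refine tendsto_order.2 ⟨fun a ha => ?_, fun a ha => ?_⟩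
  · obtain ⟨δ, hδ, haδ⟩ := (eventually_mem_nhdsWithin.and
      ((hperturb (-1)).eventually_const_lt ha)).exists
    filter_upwards [eventually_le_supPenalizedQuotient hU hd hs hδ] with ε hε
    exact (haδ.trans_eq (by ring_nf)).trans_le hε
  · obtain ⟨δ, hδ, haδ⟩ := (eventually_mem_nhdsWithin.and
      ((hperturb 1).eventually_lt_const ha)).exists
    filter_upwards [eventually_supPenalizedQuotient_le hg hd hR hs hsR hδ] with ε hε
    exact hε.trans_lt (by rwa [one_mul] at haδ)

end SupPenalizedQuotient

/-- Lebesgue measure on `U` weighted by the density `ρ`. Only the values of `ρ` on `U` matter. -/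
noncomputable def weightedVolume {α : Type*} [MeasureSpace α] (ρ : α → ℝ) (U : Set α) :
    Measure α :=
  (volume.restrict U).withDensity fun x => ENNReal.ofReal (ρ x)

section WeightedVolume

variable {α : Type*} [MeasureSpace α] {ρ : α → ℝ} {U V : Set α}

theorem ae_weightedVolume_of_ae (hU : MeasurableSet U) {p : α → Prop}
    (h : ∀ᵐ x, x ∈ U → p x) : ∀ᵐ x ∂weightedVolume ρ U, p x :=
  (withDensity_absolutelyContinuous _ _).ae_le ((ae_restrict_iff' hU).2 h)

theorem weightedVolume_restrict (hU : MeasurableSet U) (hUV : U ⊆ V) :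
    (weightedVolume ρ V).restrict U = weightedVolume ρ U := by
  rw [weightedVolume, restrict_withDensity hU, Measure.restrict_restrict hU,
    Set.inter_eq_left.2 hUV, weightedVolume]

variable [TopologicalSpace α] [OpensMeasurableSpace α]

theorem lintegral_weightedVolume (hU : MeasurableSet U) (hρ : ContinuousOn ρ U)
    (F : α → ℝ≥0∞) : ∫⁻ x, F x ∂weightedVolume ρ U = ∫⁻ x in U, ENNReal.ofReal (ρ x) * F x :=
  lintegral_withDensity_eq_lintegral_mul_non_measurable₀ _
    (hρ.aemeasurable hU).ennreal_ofReal (.of_forall fun _ => ENNReal.ofReal_lt_top) F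

theorem isFiniteMeasure_weightedVolume [T2Space α] [IsFiniteMeasureOnCompacts (volume : Measure α)]
    (hρ : ContinuousOn ρ V) (hU : IsCompact (closure U)) (hUV : closure U ⊆ V) :
    IsFiniteMeasure (weightedVolume ρ U) :=
  isFiniteMeasure_withDensity_ofReal
    (((hρ.mono hUV).integrableOn_compact hU).mono_set subset_closure).hasFiniteIntegral

end WeightedVolume

theorem ofReal_exp_le {x b : ℝ} (h : x ≤ b) :
    ENNReal.ofReal (Real.exp x) ≤ 1 + ENNReal.ofReal (Real.exp b) * ENNReal.ofReal x := by
  rcases le_total x 0 with hx | hx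
  · exact (ENNReal.ofReal_le_one.2 (Real.exp_le_one_iff.2 hx)).trans le_self_add
  have hreal : Real.exp x ≤ 1 + Real.exp b * x := by
    calc Real.exp x = 1 + Real.exp x * (1 - Real.exp (-x)) := by
          rw [mul_sub, ← Real.exp_add, add_neg_cancel, Real.exp_zero]
          ring
      _ ≤ 1 + Real.exp b * x := by
          gcongr
          · exact sub_nonneg.2 (Real.exp_le_one_iff.2 (neg_nonpos.2 hx))
          · linarith [Real.one_sub_le_exp_neg x]
  rw [← ENNReal.ofReal_mul (Real.exp_pos b).le, ← ENNReal.ofReal_one,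
    ← ENNReal.ofReal_add zero_le_one (by positivity)]
  exact ENNReal.ofReal_le_ofReal hreal

section ExpMoments

variable {n : ℕ} {ρ : (Fin n → ℝ) → ℝ} {s : (Fin n → ℝ) → Fin n → ℝ} {U : Set (Fin n → ℝ)}
  {g : (Fin n → ℝ) → ℝ} {ε : ℝ}

theorem HasLogConcavityScale.mul_exp_mul_le_sq (hρ : HasLogConcavityScale ρ s U) (hε : ε ≠ 0)
    {k z : Fin n → ℝ} (hz : z ∈ stepSet U ε k) :
    ρ (z + ε • k) * Real.exp (ε * g (z + ε • k)) *
        (ρ (z - ε • k) * Real.exp (-ε * g (z - ε • k))) ≤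
      (ρ z * Real.exp (ε ^ 2 / 2 * penalizedQuotient s g ε k z)) ^ 2 := by
  have hexponent : -∑ i, ((ε • k) i / s z i) ^ 2 + (ε * g (z + ε • k) + -ε * g (z - ε • k)) =
      2 * (ε ^ 2 / 2 * penalizedQuotient s g ε k z) := by
    simp only [penalizedQuotient, Pi.smul_apply, smul_eq_mul, mul_div_assoc, mul_pow,
      ← Finset.mul_sum]
    field_simp
    ring
  calc _ = ρ (z + ε • k) * ρ (z - ε • k) *
          Real.exp (ε * g (z + ε • k) + -ε * g (z - ε • k)) := by
        rw [Real.exp_add]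
        ring
    _ ≤ ρ z ^ 2 * Real.exp (-∑ i, ((ε • k) i / s z i) ^ 2) *
          Real.exp (ε * g (z + ε • k) + -ε * g (z - ε • k)) :=
        mul_le_mul_of_nonneg_right (hρ.mul_le z (ε • k) hz.1 hz.2) (Real.exp_pos _).le
    _ = _ := by
        rw [mul_assoc, ← Real.exp_add, hexponent, mul_pow, ← Real.exp_nat_mul, Nat.cast_ofNat]

theorem HasLogConcavityScale.indicator_mul_indicator_le_sq (hρ : HasLogConcavityScale ρ s U)
    (hconv : Convex ℝ U) (hε : 0 < ε) {B : ℝ}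
    (hB : ∀ k, ∀ z ∈ stepSet U ε k, penalizedQuotient s g ε k z ≤ B) (x y : Fin n → ℝ) :
    U.indicator (fun x => ENNReal.ofReal (ρ x) * ENNReal.ofReal (Real.exp (ε * g x))) x *
        U.indicator (fun x => ENNReal.ofReal (ρ x) * ENNReal.ofReal (Real.exp (-ε * g x))) y ≤
      U.indicator (fun x => ENNReal.ofReal (ρ x) *
        (1 + ENNReal.ofReal (ε ^ 2 / 2 * Real.exp (ε ^ 2 / 2 * B)) *
          supPenalizedQuotient s U g ε x))
        ((1 / 2 : ℝ) • (x + y)) ^ 2 := by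
  by_cases hx : x ∈ U
  swap
  · simp [Set.indicator_of_notMem hx]
  by_cases hy : y ∈ U
  swap
  · simp [Set.indicator_of_notMem hy]
  obtain ⟨z, k, rfl, rfl⟩ : ∃ z k, z + ε • k = x ∧ z - ε • k = y :=
    ⟨(1 / 2 : ℝ) • (x + y), ε⁻¹ • (1 / 2 : ℝ) • (x - y), by rw [smul_inv_smul₀ hε.ne']; module,
      by rw [smul_inv_smul₀ hε.ne']; module⟩
  have hmid : (1 / 2 : ℝ) • (z + ε • k + (z - ε • k)) = z := by module
  have hz : z ∈ stepSet U ε k := ⟨hx, hy⟩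
  have hzU : z ∈ U := stepSet_subset hconv ε k hz
  rw [hmid, Set.indicator_of_mem hx, Set.indicator_of_mem hy, Set.indicator_of_mem hzU,
    ← ENNReal.ofReal_mul (hρ.pos _ hx).le, ← ENNReal.ofReal_mul (hρ.pos _ hy).le,
    ← ENNReal.ofReal_mul (mul_pos (hρ.pos _ hx) (Real.exp_pos _)).le]
  have hq : ε ^ 2 / 2 * penalizedQuotient s g ε k z ≤ ε ^ 2 / 2 * B := by
    gcongr
    exact hB k z hz
  calc _ ≤ ENNReal.ofReal ((ρ z * Real.exp (ε ^ 2 / 2 * penalizedQuotient s g ε k z)) ^ 2) :=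
        ENNReal.ofReal_le_ofReal (hρ.mul_exp_mul_le_sq hε.ne' hz)
    _ = (ENNReal.ofReal (ρ z) *
          ENNReal.ofReal (Real.exp (ε ^ 2 / 2 * penalizedQuotient s g ε k z))) ^ 2 := by
        rw [ENNReal.ofReal_pow (mul_pos (hρ.pos z hzU) (Real.exp_pos _)).le,
          ENNReal.ofReal_mul (hρ.pos z hzU).le]
    _ ≤ _ := by
        gcongr
        refine (ofReal_exp_le hq).trans ?_
        rw [ENNReal.ofReal_mul (by positivity), ENNReal.ofReal_mul (by positivity),
          mul_left_comm, ← mul_assoc]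
        gcongr
        exact ofReal_penalizedQuotient_le_sup hz

theorem HasLogConcavityScale.exp_moments_le (hρ : HasLogConcavityScale ρ s U) (hU : IsOpen U)
    (hconv : Convex ℝ U) (hg : ContinuousOn g U) (hε : 0 < ε) {B : ℝ}
    (hB : ∀ k, ∀ z ∈ stepSet U ε k, penalizedQuotient s g ε k z ≤ B) :
    (∫⁻ x, ENNReal.ofReal (Real.exp (ε * g x)) ∂weightedVolume ρ U) *
        ∫⁻ x, ENNReal.ofReal (Real.exp (-ε * g x)) ∂weightedVolume ρ U ≤
      (weightedVolume ρ U Set.univ + ENNReal.ofReal (ε ^ 2 / 2 * Real.exp (ε ^ 2 / 2 * B)) *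
        ∫⁻ x, supPenalizedQuotient s U g ε x ∂weightedVolume ρ U) ^ 2 := by
  have hQ := measurable_supPenalizedQuotient hU hconv hρ.continuousOn_scale hρ.scale_pos hg ε
  have hρm : ContinuousOn (fun x => ENNReal.ofReal (ρ x)) U :=
    ENNReal.continuous_ofReal.comp_continuousOn hρ.continuousOn
  have hexp (t : ℝ) : Measurable
      (U.indicator fun x => ENNReal.ofReal (ρ x) * ENNReal.ofReal (Real.exp (t * g x))) := by
    refine (lowerSemicontinuous_indicator_of_continuousOn hU ?_).measurable
    simp only [← ENNReal.ofReal_mul' (Real.exp_pos _).le]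
    exact ENNReal.continuous_ofReal.comp_continuousOn
      (hρ.continuousOn.mul (Real.continuous_exp.comp_continuousOn (hg.const_mul t)))
  set a := ENNReal.ofReal (ε ^ 2 / 2 * Real.exp (ε ^ 2 / 2 * B))
  have hfactor : Measurable fun x => 1 + a * supPenalizedQuotient s U g ε x :=
    measurable_const.add (hQ.const_mul a)
  have hw : Measurable (U.indicator fun x =>
      ENNReal.ofReal (ρ x) * (1 + a * supPenalizedQuotient s U g ε x)) := by
    convert (lowerSemicontinuous_indicator_of_continuousOn hU hρm).measurable.mul hfactor using 1
    exact funext fun x => Set.indicator_mul_left _ _ _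
  have hPL := prekopaLeindler (hexp ε) (hexp (-ε)) hw
    (hρ.indicator_mul_indicator_le_sq hconv hε hB)
  simp only [lintegral_indicator hU.measurableSet,
    ← lintegral_weightedVolume hU.measurableSet hρ.continuousOn] at hPL
  rwa [lintegral_add_left measurable_const, lintegral_const_mul _ hQ, lintegral_one] at hPL

end ExpMoments

section Variance

variable {n : ℕ} {ρ : (Fin n → ℝ) → ℝ} {s : (Fin n → ℝ) → Fin n → ℝ} {U : Set (Fin n → ℝ)}
  {g : (Fin n → ℝ) → ℝ} {ε R : ℝ} {L : NNReal}

theorem HasLogConcavityScale.ae_supPenalizedQuotient_le (hρ : HasLogConcavityScale ρ s U)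
    (hU : MeasurableSet U) (hg : LipschitzOnWith L g U) (hR : 0 ≤ R)
    (hsR : ∀ z ∈ U, ∀ i, s z i ≤ R) (hε : 0 < ε) :
    ∀ᵐ z ∂weightedVolume ρ U, supPenalizedQuotient s U g ε z ≤ ENNReal.ofReal ((L * R) ^ 2) :=
  ae_weightedVolume_of_ae hU <| .of_forall fun z hz => supPenalizedQuotient_le fun _ hk =>
    ENNReal.ofReal_le_ofReal <|
      penalizedQuotient_le_sq hg hε hR (hρ.scale_pos z hz) (hsR z hz) hk

theorem HasLogConcavityScale.lintegral_supPenalizedQuotient_le (hρ : HasLogConcavityScale ρ s U)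
    (hU : MeasurableSet U) (hg : LipschitzOnWith L g U) (hR : 0 ≤ R)
    (hsR : ∀ z ∈ U, ∀ i, s z i ≤ R) (hε : 0 < ε) :
    ∫⁻ z, supPenalizedQuotient s U g ε z ∂weightedVolume ρ U ≤
      ENNReal.ofReal ((L * R) ^ 2) * weightedVolume ρ U Set.univ :=
  (lintegral_mono_ae (hρ.ae_supPenalizedQuotient_le hU hg hR hsR hε)).trans_eq (lintegral_const _)

theorem HasLogConcavityScale.tendsto_lintegral_supPenalizedQuotient
    [IsFiniteMeasure (weightedVolume ρ U)] (hρ : HasLogConcavityScale ρ s U)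
    (hU : IsOpen U) (hconv : Convex ℝ U) (hg : LipschitzOnWith L g U) (hR : 0 ≤ R)
    (hsR : ∀ z ∈ U, ∀ i, s z i ≤ R) :
    Tendsto (fun ε => ∫⁻ z, supPenalizedQuotient s U g ε z ∂weightedVolume ρ U) (𝓝[>] 0)
      (𝓝 (∫⁻ z, ENNReal.ofReal (scaledGradSq s g z) ∂weightedVolume ρ U)) := by
  refine tendsto_lintegral_filter_of_dominated_convergence
    (fun _ => ENNReal.ofReal ((L * R) ^ 2)) (.of_forall fun ε =>
      measurable_supPenalizedQuotient hU hconv hρ.continuousOn_scale hρ.scale_pos hg.continuousOn ε)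
    ?_ ?_ (ae_weightedVolume_of_ae hU.measurableSet ?_)
  · filter_upwards [self_mem_nhdsWithin] with ε hε
    exact hρ.ae_supPenalizedQuotient_le hU.measurableSet hg hR hsR hε
  · simpa using ENNReal.mul_ne_top ENNReal.ofReal_ne_top (measure_ne_top _ Set.univ)
  · filter_upwards [hg.ae_differentiableWithinAt_of_mem] with z hd hz
    have hzU := hU.mem_nhds hz
    exact tendsto_supPenalizedQuotient hzU hg ((hd hz).differentiableAt hzU) hR
      (hρ.scale_pos z hz) (hsR z hz)

theorem HasLogConcavityScale.mgf_mul_mgf_le [IsFiniteMeasure (weightedVolume ρ U)]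
    (hρ : HasLogConcavityScale ρ s U) (hU : IsOpen U) (hconv : Convex ℝ U)
    (hg : LipschitzOnWith L g U) (hR : 0 ≤ R) (hsR : ∀ z ∈ U, ∀ i, s z i ≤ R)
    (hexp : ∀ t : ℝ, Integrable (fun x => Real.exp (t * g x)) (weightedVolume ρ U)) (hε : 0 < ε) :
    mgf g (weightedVolume ρ U) ε * mgf g (weightedVolume ρ U) (-ε) ≤
      ((weightedVolume ρ U).real Set.univ + ε ^ 2 / 2 * (Real.exp (ε ^ 2 / 2 * (L * R) ^ 2) *
        (∫⁻ z, supPenalizedQuotient s U g ε z ∂weightedVolume ρ U).toReal)) ^ 2 := by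
  have hQ : ∫⁻ z, supPenalizedQuotient s U g ε z ∂weightedVolume ρ U ≠ ⊤ := ne_top_of_le_ne_top
    (by finiteness) (hρ.lintegral_supPenalizedQuotient_le hU.measurableSet hg hR hsR hε)
  have hmoments := hρ.exp_moments_le hU hconv hg.continuousOn hε fun k z hk =>
    have hz := stepSet_subset hconv ε k hk
    penalizedQuotient_le_sq hg hε hR (hρ.scale_pos z hz) (hsR z hz) hk
  have hmgf (t : ℝ) : ∫⁻ x, ENNReal.ofReal (Real.exp (t * g x)) ∂weightedVolume ρ U =
      ENNReal.ofReal (mgf g (weightedVolume ρ U) t) :=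
    (ofReal_integral_eq_lintegral_ofReal (hexp t) (.of_forall fun _ => (Real.exp_pos _).le)).symm
  have hreal := ENNReal.toReal_mono (by finiteness) hmoments
  rw [hmgf, hmgf, ENNReal.toReal_mul, ENNReal.toReal_ofReal mgf_nonneg,
    ENNReal.toReal_ofReal mgf_nonneg, ENNReal.toReal_pow,
    ENNReal.toReal_add (measure_ne_top _ _) (by finiteness), ENNReal.toReal_mul,
    ENNReal.toReal_ofReal (by positivity), mul_assoc] at hreal
  exact hreal

theorem HasLogConcavityScale.variance_le [IsFiniteMeasure (weightedVolume ρ U)]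
    (hρ : HasLogConcavityScale ρ s U) (hU : IsOpen U) (hconv : Convex ℝ U)
    (hg : LipschitzOnWith L g U) (hR : 0 ≤ R) (hsR : ∀ z ∈ U, ∀ i, s z i ≤ R) {a b : ℝ}
    (hab : ∀ z ∈ U, g z ∈ Set.Icc a b) :
    (weightedVolume ρ U).real Set.univ * ∫ x, g x ^ 2 ∂weightedVolume ρ U -
        (∫ x, g x ∂weightedVolume ρ U) ^ 2 ≤
      (weightedVolume ρ U).real Set.univ *
        (∫⁻ x, ENNReal.ofReal (scaledGradSq s g x) ∂weightedVolume ρ U).toReal := by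
  have hmeas : AEMeasurable g (weightedVolume ρ U) :=
    (hg.continuousOn.aemeasurable hU.measurableSet).mono_ac (withDensity_absolutelyContinuous _ _)
  have hbounded : ∀ᵐ x ∂weightedVolume ρ U, g x ∈ Set.Icc a b :=
    ae_weightedVolume_of_ae hU.measurableSet (.of_forall hab)
  have hexp (t : ℝ) : Integrable (fun x => Real.exp (t * g x)) (weightedVolume ρ U) :=
    integrable_exp_mul_of_mem_Icc hmeas hbounded
  have hlim := hρ.tendsto_lintegral_supPenalizedQuotient hU hconv hg hR hsR
  have hD : ∫⁻ x, ENNReal.ofReal (scaledGradSq s g x) ∂weightedVolume ρ U ≠ ⊤ := by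
    refine ne_top_of_le_ne_top (b := ENNReal.ofReal ((L * R) ^ 2) * weightedVolume ρ U Set.univ)
      (by finiteness) (le_of_tendsto hlim ?_)
    filter_upwards [self_mem_nhdsWithin] with ε hε
    exact hρ.lintegral_supPenalizedQuotient_le hU.measurableSet hg hR hsR hε
  have hη : Tendsto (fun ε => Real.exp (ε ^ 2 / 2 * (L * R) ^ 2) *
      (∫⁻ z, supPenalizedQuotient s U g ε z ∂weightedVolume ρ U).toReal) (𝓝[>] 0)
      (𝓝 (∫⁻ x, ENNReal.ofReal (scaledGradSq s g x) ∂weightedVolume ρ U).toReal) := by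
    have hfactor : Tendsto (fun ε : ℝ => Real.exp (ε ^ 2 / 2 * (L * R) ^ 2)) (𝓝[>] 0) (𝓝 1) := by
      refine (Continuous.tendsto' (by fun_prop) 0 1 ?_).mono_left nhdsWithin_le_nhds
      simp
    simpa using hfactor.mul ((ENNReal.tendsto_toReal hD).comp hlim)
  refine le_of_eventually_sq_add_sq_mul_le hη ?_
  filter_upwards [self_mem_nhdsWithin] with ε hε
  exact (sq_add_sq_mul_le_mgf_mul_mgf (memLp_of_bounded hbounded hmeas.aestronglyMeasurable 2)
    (hexp ε) (hexp (-ε))).trans (hρ.mgf_mul_mgf_le hU hconv hg hR hsR hexp hε)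

end Variance

theorem convex_setOf_ball_subset {E : Type*} [SeminormedAddCommGroup E] [NormedSpace ℝ E]
    {V : Set E} (hV : Convex ℝ V) (r : ℝ) : Convex ℝ {x | Metric.ball x r ⊆ V} := by
  intro x hx y hy a b ha hb hab w hw
  set v := w - (a • x + b • y) with hv
  have hvr : ‖v‖ < r := mem_ball_iff_norm.1 hw
  have hsplit : a • (x + v) + b • (y + v) = w := by
    rw [smul_add, smul_add, add_add_add_comm, ← add_smul, hab, one_smul, hv, add_sub_cancel]
  exact hsplit ▸ hV (hx (by simpa using hvr)) (hy (by simpa using hvr)) ha hb hab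

theorem exists_monotone_isOpen_convex_iUnion_eq {E : Type*} [NormedAddCommGroup E]
    [NormedSpace ℝ E] [ProperSpace E] {V : Set E} (hV : IsOpen V) (hconv : Convex ℝ V) :
    ∃ U : ℕ → Set E, Monotone U ∧ ⋃ j, U j = V ∧
      ∀ j, IsOpen (U j) ∧ Convex ℝ (U j) ∧ IsCompact (closure (U j)) ∧ closure (U j) ⊆ V := by
  let S (j : ℕ) : Set E := {x | Metric.ball x (1 / (j + 1)) ⊆ V}
  have hS : Monotone S := fun i j hij x hx =>
    (Metric.ball_subset_ball (one_div_le_one_div_of_le (by positivity) (by gcongr))).trans hx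
  have hclosure (j : ℕ) : closure (S j) ⊆ V := fun x hx => by
    obtain ⟨y, hy, hxy⟩ := Metric.mem_closure_iff.1 hx (1 / (j + 1)) (by positivity)
    exact hy hxy
  refine ⟨fun j => interior (S j) ∩ Metric.ball 0 j, fun i j hij =>
    Set.inter_subset_inter (interior_mono (hS hij)) (Metric.ball_subset_ball (by gcongr)),
    subset_antisymm (Set.iUnion_subset fun j => ?_) fun x hx => ?_, fun j =>
    ⟨isOpen_interior.inter Metric.isOpen_ball,
      (convex_setOf_ball_subset hconv _).interior.inter (convex_ball _ _),
      (Metric.isBounded_ball.subset Set.inter_subset_right).isCompact_closure,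
      (closure_mono (Set.inter_subset_left.trans interior_subset)).trans (hclosure j)⟩⟩
  · exact Set.inter_subset_left.trans
      (interior_subset.trans (subset_closure.trans (hclosure j)))
  · obtain ⟨δ, hδ, hball⟩ := Metric.isOpen_iff.1 hV x hx
    obtain ⟨j, hj⟩ := exists_nat_one_div_lt (half_pos hδ)
    obtain ⟨m, hm⟩ := exists_nat_gt ‖x‖
    have hxS : x ∈ interior (S j) := by
      refine mem_interior.2 ⟨Metric.ball x (δ / 2), fun y hy => ?_, Metric.isOpen_ball,
        Metric.mem_ball_self (half_pos hδ)⟩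
      refine (Metric.ball_subset_ball' ?_).trans hball
      linarith [Metric.mem_ball.1 hy]
    refine Set.mem_iUnion.2 ⟨max j m, interior_mono (hS (le_max_left j m)) hxS, ?_⟩
    rw [mem_ball_zero_iff]
    exact hm.trans_le (by exact_mod_cast le_max_right j m)

theorem setLIntegral_iUnion_le_of_forall_le_add {α : Type*} [MeasurableSpace α] {μ : Measure α}
    {U : ℕ → Set α} (hmono : Monotone U) (hU : ∀ j, MeasurableSet (U j))
    (hfinite : ∀ j, μ (U j) ≠ ⊤)
    {g : α → ℝ} (hint : IntegrableOn g (⋃ j, U j) μ) (hzero : ∫ x in ⋃ j, U j, g x ∂μ = 0)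
    {F : α → ℝ≥0∞} {D : ℝ≥0∞} (h : ∀ j, ∫⁻ x in U j, F x ∂μ ≤
      D + ENNReal.ofReal ((∫ x in U j, g x ∂μ) ^ 2 / μ.real (U j))) :
    ∫⁻ x in ⋃ j, U j, F x ∂μ ≤ D := by
  by_cases hnull : ∀ j, μ (U j) = 0
  · simp [setLIntegral_measure_zero _ _ (measure_iUnion_null hnull)]
  obtain ⟨N, hN⟩ := not_forall.1 hnull
  have hmean : Tendsto (fun j => ∫ x in U j, g x ∂μ) atTop (𝓝 0) :=
    hzero ▸ tendsto_setIntegral_of_monotone hU hmono hint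
  have hbound : ∀ j ≥ N, ∫⁻ x in U j, F x ∂μ ≤
      D + ENNReal.ofReal ((∫ x in U j, g x ∂μ) ^ 2 / μ.real (U N)) := fun j hj => by
    refine (h j).trans ?_
    gcongr
    · exact ENNReal.toReal_pos hN (hfinite N)
    · exact hfinite j
    · exact hmono hj
  have hleft : Tendsto (fun j => ∫⁻ x in U j, F x ∂μ) atTop (𝓝 (∫⁻ x in ⋃ j, U j, F x ∂μ)) := by
    rw [setLIntegral_iUnion_of_directed _ hmono.directed_le]
    exact tendsto_atTop_iSup fun i j hij => lintegral_mono_set (hmono hij)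
  have hright : Tendsto (fun j => D + ENNReal.ofReal ((∫ x in U j, g x ∂μ) ^ 2 / μ.real (U N)))
      atTop (𝓝 D) := by
    simpa using (ENNReal.tendsto_ofReal ((hmean.pow 2).div_const (μ.real (U N)))).const_add D
  exact le_of_tendsto_of_tendsto hleft hright ((eventually_ge_atTop N).mono hbound)

section BrascampLieb

variable {n : ℕ} {ρ : (Fin n → ℝ) → ℝ} {s : (Fin n → ℝ) → Fin n → ℝ} {U V : Set (Fin n → ℝ)}
  {g : (Fin n → ℝ) → ℝ}

theorem HasLogConcavityScale.lintegral_sq_le_add (hρ : HasLogConcavityScale ρ s V)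
    (hg : LocallyLipschitzOn V g) (hU : IsOpen U) (hconv : Convex ℝ U)
    (hcompact : IsCompact (closure U)) (hUV : closure U ⊆ V) :
    ∫⁻ x, ENNReal.ofReal (g x ^ 2) ∂weightedVolume ρ U ≤
      ∫⁻ x, ENNReal.ofReal (scaledGradSq s g x) ∂weightedVolume ρ U +
        ENNReal.ofReal ((∫ x, g x ∂weightedVolume ρ U) ^ 2 /
          (weightedVolume ρ U).real Set.univ) := by
  have hfinite := isFiniteMeasure_weightedVolume hρ.continuousOn hcompact hUV
  obtain ⟨L, hL⟩ := (hg.mono hUV).exists_lipschitzOnWith_of_compact hcompact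
  obtain ⟨C, hC⟩ := hcompact.exists_bound_of_continuousOn hL.continuousOn
  obtain ⟨R, hR⟩ := hcompact.exists_bound_of_continuousOn (hρ.continuousOn_scale.mono hUV)
  have hρU := hρ.mono (subset_closure.trans hUV)
  have hgU := hL.mono subset_closure
  have hgC : ∀ z ∈ U, g z ∈ Set.Icc (-C) C := fun z hz => abs_le.1 (hC z (subset_closure hz))
  have hsR : ∀ z ∈ U, ∀ i, s z i ≤ |R| := fun z hz i => (le_abs_self _).trans <|
    (norm_le_pi_norm (s z) i).trans <| (hR z (subset_closure hz)).trans (le_abs_self R)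
  have hvar := hρU.variance_le hU hconv hgU (abs_nonneg R) hsR hgC
  set μ := weightedVolume ρ U
  rcases eq_zero_or_neZero μ with hμ | hμ
  · simp [hμ]
  set D := ∫⁻ x, ENNReal.ofReal (scaledGradSq s g x) ∂μ
  rcases eq_or_ne D ⊤ with hD | hD
  · simp [hD]
  have hL2 : MemLp g 2 μ := memLp_of_bounded
    (ae_weightedVolume_of_ae hU.measurableSet (.of_forall hgC))
    ((hgU.continuousOn.aestronglyMeasurable hU.measurableSet).mono_ac
      (withDensity_absolutelyContinuous _ _)) 2
  have hM : 0 < μ.real Set.univ := measureReal_univ_pos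
  have hsq : ∫ x, g x ^ 2 ∂μ ≤ D.toReal + (∫ x, g x ∂μ) ^ 2 / μ.real Set.univ := by
    rw [← mul_le_mul_iff_right₀ hM, mul_add, mul_div_cancel₀ _ hM.ne']
    linarith
  rw [← ofReal_integral_eq_lintegral_ofReal hL2.integrable_sq (.of_forall fun _ => sq_nonneg _)]
  refine (ENNReal.ofReal_le_ofReal hsq).trans ?_
  rw [ENNReal.ofReal_add ENNReal.toReal_nonneg (by positivity), ENNReal.ofReal_toReal hD]

theorem HasLogConcavityScale.lintegral_sq_le (hρ : HasLogConcavityScale ρ s V) (hV : IsOpen V)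
    (hconv : Convex ℝ V) (hg : LocallyLipschitzOn V g)
    (hint : Integrable g (weightedVolume ρ V)) (hzero : ∫ x, g x ∂weightedVolume ρ V = 0) :
    ∫⁻ x, ENNReal.ofReal (g x ^ 2) ∂weightedVolume ρ V ≤
      ∫⁻ x, ENNReal.ofReal (scaledGradSq s g x) ∂weightedVolume ρ V := by
  obtain ⟨U, hmono, rfl, hU⟩ := exists_monotone_isOpen_convex_iUnion_eq hV hconv
  have hrestrict : ∀ j, (weightedVolume ρ (⋃ j, U j)).restrict (U j) = weightedVolume ρ (U j) :=
    fun j => weightedVolume_restrict (hU j).1.measurableSet (Set.subset_iUnion U j)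
  have hrestrict_iUnion :=
    weightedVolume_restrict (ρ := ρ) hV.measurableSet (subset_refl (⋃ j, U j))
  rw [← hrestrict_iUnion] at hint hzero
  conv_lhs => rw [← hrestrict_iUnion]
  refine setLIntegral_iUnion_le_of_forall_le_add hmono (fun j => (hU j).1.measurableSet)
    (fun j => ?_) hint hzero fun j => ?_
  all_goals obtain ⟨hopen, hconvU, hcompact, hsub⟩ := hU j
  · have := isFiniteMeasure_weightedVolume hρ.continuousOn hcompact hsub
    rw [← Measure.restrict_apply_univ, hrestrict]
    exact measure_ne_top _ _
  · rw [← measureReal_restrict_apply_univ, hrestrict]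
    refine (hρ.lintegral_sq_le_add hg hopen hconvU hcompact hsub).trans ?_
    rw [← hrestrict]
    gcongr
    exact Measure.restrict_le_self

end BrascampLieb

/-! ### Coordinatewise power maps -/

section CoordRpow

variable {n : ℕ} {p m c : ℝ} {x : Fin n → ℝ} {V : Set (Fin n → ℝ)} {f : (Fin n → ℝ) → ℝ}

theorem isOpen_posOrthant (n : ℕ) : IsOpen (posOrthant n) := by
  simp only [posOrthant, Set.ofPred_forall]
  exact isOpen_iInter_of_finite fun i => isOpen_lt continuous_const (continuous_apply i)

/-- The weight `∏ i, c * x i ^ m`, the Jacobian of a coordinatewise power map. -/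
noncomputable def powerWeight (c m : ℝ) (x : Fin n → ℝ) : ℝ := ∏ i, c * x i ^ m

theorem powerWeight_pos (hc : 0 < c) (hx : x ∈ posOrthant n) : 0 < powerWeight c m x :=
  Finset.prod_pos fun i _ => mul_pos hc (Real.rpow_pos_of_pos (hx i) m)

theorem rpow_add_mul_rpow_sub_le {a b : ℝ} (hm : 0 ≤ m) (hadd : 0 < a + b) (hsub : 0 < a - b) :
    (a + b) ^ m * (a - b) ^ m ≤ (a ^ m) ^ 2 * Real.exp (-(m * (b / a) ^ 2)) := by
  have ha : 0 < a := by linarith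
  have hfactor : (a + b) * (a - b) = a ^ 2 * (1 - (b / a) ^ 2) := by
    field_simp
    ring
  have hle : (a + b) * (a - b) ≤ a ^ 2 * Real.exp (-(b / a) ^ 2) := by
    rw [hfactor]
    gcongr
    exact Real.one_sub_le_exp_neg _
  calc (a + b) ^ m * (a - b) ^ m = ((a + b) * (a - b)) ^ m :=
        (Real.mul_rpow hadd.le hsub.le).symm
    _ ≤ (a ^ 2 * Real.exp (-(b / a) ^ 2)) ^ m := by gcongr
    _ = (a ^ m) ^ 2 * Real.exp (-(m * (b / a) ^ 2)) := by
        rw [Real.mul_rpow (by positivity) (Real.exp_pos _).le, ← Real.exp_mul,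
          ← Real.rpow_natCast_mul ha.le, ← Real.rpow_mul_natCast ha.le]
        ring_nf

theorem hasLogConcavityScale_powerWeight (hc : 0 < c) (hm : 0 < m) :
    HasLogConcavityScale (powerWeight c m) (fun z i => z i / √m) (posOrthant n) where
  pos _ := powerWeight_pos hc
  continuousOn := continuousOn_finsetProd _ fun i _ => continuousOn_const.mul <|
    (continuous_apply i).continuousOn.rpow_const fun z hz => .inl (hz i).ne'
  scale_pos z hz i := div_pos (hz i) (Real.sqrt_pos.2 hm)
  continuousOn_scale := by fun_prop
  mul_le z h hadd hsub := by
    have hscale (i : Fin n) : (h i / (z i / √m)) ^ 2 = m * (h i / z i) ^ 2 := by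
      rw [div_div_eq_mul_div, div_pow, mul_pow, Real.sq_sqrt hm.le]
      ring
    simp only [hscale, powerWeight]
    rw [← Finset.sum_neg_distrib, Real.exp_sum, ← Finset.prod_pow, ← Finset.prod_mul_distrib,
      ← Finset.prod_mul_distrib]
    refine Finset.prod_le_prod (fun i _ => ?_) fun i _ => ?_
    · exact mul_nonneg (mul_pos hc (Real.rpow_pos_of_pos (hadd i) m)).le
        (mul_pos hc (Real.rpow_pos_of_pos (hsub i) m)).le
    · calc c * (z i + h i) ^ m * (c * (z i - h i) ^ m)
          = c ^ 2 * ((z i + h i) ^ m * (z i - h i) ^ m) := by ring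
        _ ≤ c ^ 2 * ((z i ^ m) ^ 2 * Real.exp (-(m * (h i / z i) ^ 2))) :=
          mul_le_mul_of_nonneg_left (rpow_add_mul_rpow_sub_le hm.le (hadd i) (hsub i))
            (sq_nonneg c)
        _ = _ := by ring

/-- The coordinatewise power map; `IsPConvex p K` says that `K` lies in the positive orthant and
has convex image under `coordRpow p`. -/
noncomputable def coordRpow (p : ℝ) (x : Fin n → ℝ) : Fin n → ℝ := fun i => x i ^ p

/-- The derivative of `coordRpow p` at `x`, diagonal in the standard basis. -/
noncomputable def coordRpowDeriv (p : ℝ) (x : Fin n → ℝ) : (Fin n → ℝ) →L[ℝ] (Fin n → ℝ) :=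
  .pi fun i => ((p * x i ^ (p - 1)) • ContinuousLinearMap.id ℝ ℝ) ∘SL .proj i

theorem coordRpow_mem_posOrthant (hx : x ∈ posOrthant n) : coordRpow p x ∈ posOrthant n :=
  fun i => Real.rpow_pos_of_pos (hx i) p

theorem coordRpow_coordRpow_inv (hp : p ≠ 0) (hx : x ∈ posOrthant n) :
    coordRpow p (coordRpow p⁻¹ x) = x :=
  funext fun i => Real.rpow_inv_rpow (hx i).le hp

theorem coordRpow_inv_coordRpow (hp : p ≠ 0) (hx : x ∈ posOrthant n) :
    coordRpow p⁻¹ (coordRpow p x) = x :=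
  funext fun i => Real.rpow_rpow_inv (hx i).le hp

theorem injOn_coordRpow (hp : p ≠ 0) : Set.InjOn (coordRpow p) (posOrthant n) :=
  Set.LeftInvOn.injOn fun _ hx => coordRpow_inv_coordRpow hp hx

theorem measurable_coordRpow : Measurable (coordRpow p : (Fin n → ℝ) → Fin n → ℝ) := by
  unfold coordRpow
  fun_prop

theorem hasFDerivAt_coordRpow (hx : x ∈ posOrthant n) :
    HasFDerivAt (coordRpow p) (coordRpowDeriv p x) x :=
  hasFDerivAt_pi.2 fun i => by
    have hproj : HasFDerivAt (fun x : Fin n → ℝ => x i) (.proj i) x :=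
      (ContinuousLinearMap.proj (R := ℝ) (φ := fun _ : Fin n => ℝ) i).hasFDerivAt
    refine ((Real.hasDerivAt_rpow_const (p := p) (.inl (hx i).ne')).comp_hasFDerivAt x
      hproj).congr_fderiv ?_
    ext v
    simp

theorem det_coordRpowDeriv : (coordRpowDeriv p x).det = powerWeight p (p - 1) x := by
  rw [coordRpowDeriv, ContinuousLinearMap.det_pi, powerWeight]
  simp [ContinuousLinearMap.det]

theorem isOpen_image_coordRpow (hp : p ≠ 0) (hV : IsOpen V) (hpos : V ⊆ posOrthant n) :
    IsOpen (coordRpow p '' V) := by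
  have himage : coordRpow p '' V = posOrthant n ∩ coordRpow p⁻¹ ⁻¹' V := by
    ext x
    constructor
    · rintro ⟨y, hy, rfl⟩
      exact ⟨coordRpow_mem_posOrthant (hpos hy),
        by rwa [Set.mem_preimage, coordRpow_inv_coordRpow hp (hpos hy)]⟩
    · exact fun hx => ⟨_, hx.2, coordRpow_coordRpow_inv hp hx.1⟩
  rw [himage]
  exact ContinuousOn.isOpen_inter_preimage
    (fun x hx => (hasFDerivAt_coordRpow hx).continuousAt.continuousWithinAt)
    (isOpen_posOrthant n) hV

theorem map_coordRpow_weightedVolume (hp : 0 < p) (hV : MeasurableSet V)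
    (hpos : V ⊆ posOrthant n) :
    (weightedVolume (powerWeight p (p - 1)) V).map (coordRpow p) =
      volume.restrict (coordRpow p '' V) := by
  rw [← map_withDensity_abs_det_fderiv_eq_addHaar volume hV.nullMeasurableSet
    (fun y hy => (hasFDerivAt_coordRpow (hpos hy)).hasFDerivWithinAt)
    ((injOn_coordRpow hp.ne').mono hpos), weightedVolume]
  congr 1
  refine withDensity_congr_ae ((ae_restrict_iff' hV).2 (.of_forall fun y hy => ?_))
  simp only [det_coordRpowDeriv, abs_of_pos (powerWeight_pos hp (hpos hy))]

theorem coordRpowDeriv_single (i : Fin n) :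
    coordRpowDeriv p x (Pi.single i 1) = (p * x i ^ (p - 1)) • Pi.single i 1 := by
  ext j
  rcases eq_or_ne j i with rfl | h
  · simp [coordRpowDeriv]
  · simp [coordRpowDeriv, h]

theorem mul_partialDeriv_comp_coordRpow (hx : x ∈ posOrthant n)
    (hf : DifferentiableAt ℝ f (coordRpow p x)) (i : Fin n) :
    x i * partialDeriv i (f ∘ coordRpow p) x =
      p * (coordRpow p x i * partialDeriv i f (coordRpow p x)) := by
  have hcomp := hf.hasFDerivAt.comp x (hasFDerivAt_coordRpow hx)
  rw [partialDeriv, partialDeriv, hcomp.differentiableAt.lineDeriv_eq_fderiv,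
    hf.lineDeriv_eq_fderiv, hcomp.fderiv, ContinuousLinearMap.comp_apply, coordRpowDeriv_single,
    map_smul, smul_eq_mul, Real.rpow_sub_one (hx i).ne', coordRpow]
  field_simp [(hx i).ne']

theorem scaledGradSq_comp_coordRpow (hm : 0 ≤ m) (hx : x ∈ posOrthant n)
    (hf : DifferentiableAt ℝ f (coordRpow p x)) :
    scaledGradSq (fun z i => z i / √m) (f ∘ coordRpow p) x =
      p ^ 2 / m * scaledGradSq id f (coordRpow p x) := by
  rw [scaledGradSq, scaledGradSq, Finset.mul_sum]
  refine Finset.sum_congr rfl fun i _ => ?_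
  rw [div_mul_eq_mul_div, mul_partialDeriv_comp_coordRpow hx hf, div_pow, Real.sq_sqrt hm, id]
  ring

theorem locallyLipschitz_coordRpow (hp : 1 ≤ p) :
    LocallyLipschitz (coordRpow p : (Fin n → ℝ) → Fin n → ℝ) :=
  ContDiff.locallyLipschitz (𝕂 := ℝ) <| contDiff_pi.2 fun i =>
    (Real.contDiff_rpow_const_of_le (n := 1) (by exact_mod_cast hp)).comp (contDiff_apply ℝ ℝ i)

end CoordRpow

theorem locallyLipschitzOn_comp {α β γ : Type*} [PseudoEMetricSpace α] [PseudoEMetricSpace β]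
    [PseudoEMetricSpace γ] {f : β → γ} {φ : α → β} {S : Set α} {T : Set β}
    (hf : LocallyLipschitzOn T f) (hφ : LocallyLipschitzOn S φ) (hmaps : Set.MapsTo φ S T) :
    LocallyLipschitzOn S (f ∘ φ) := fun x hx => by
  obtain ⟨A, s, hs, hfs⟩ := hf (hmaps hx)
  obtain ⟨B, t, ht, hφt⟩ := hφ hx
  exact ⟨A * B, t ∩ φ ⁻¹' s,
    inter_mem ht ((hφ.continuousOn x hx).tendsto_nhdsWithin hmaps hs),
    hfs.comp (hφt.mono Set.inter_subset_left) fun z hz => hz.2⟩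

theorem ae_differentiableAt_of_locallyLipschitzOn {E : Type*} [NormedAddCommGroup E]
    [NormedSpace ℝ E] [FiniteDimensional ℝ E] [MeasurableSpace E] [BorelSpace E] {μ : Measure E}
    [μ.IsAddHaarMeasure] {V : Set E} (hV : IsOpen V) {g : E → ℝ} (hg : LocallyLipschitzOn V g) :
    ∀ᵐ x ∂μ, x ∈ V → DifferentiableAt ℝ g x := by
  rw [ae_iff]
  refine measure_null_of_locally_null _ fun x hx => ?_
  obtain ⟨hxV, -⟩ := Classical.not_imp.1 hx
  obtain ⟨L, u, hu, hL⟩ := hg hxV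
  rw [hV.nhdsWithin_eq hxV] at hu
  refine ⟨interior u ∩ {x | ¬(x ∈ V → DifferentiableAt ℝ g x)},
    inter_mem (mem_nhdsWithin_of_mem_nhds (interior_mem_nhds.2 hu)) self_mem_nhdsWithin, ?_⟩
  refine measure_mono_null ?_ (ae_iff.1 (hL.ae_differentiableWithinAt_of_mem (μ := μ)))
  exact fun z hz hd => hz.2 fun _ =>
    (hd (interior_subset hz.1)).differentiableAt (mem_interior_iff_mem_nhds.1 hz.1)

section PConvex

variable {n : ℕ} {p : ℝ} {K V : Set (Fin n → ℝ)} {f : (Fin n → ℝ) → ℝ}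

theorem IsPConvex.exists_isOpen_convex_image_ae_eq (hp : p ≠ 0) (hK : IsPConvex p⁻¹ K) :
    ∃ V : Set (Fin n → ℝ), IsOpen V ∧ Convex ℝ V ∧ V ⊆ posOrthant n ∧ coordRpow p '' V ⊆ K ∧
      coordRpow p '' V =ᵐ[volume] K := by
  obtain ⟨hpos, hconv⟩ := hK
  set P := coordRpow p⁻¹ '' K with hP
  change Convex ℝ P at hconv
  have himage : coordRpow p '' P = K := by
    rw [hP, Set.image_image, Set.image_congr fun x hx => coordRpow_coordRpow_inv hp (hpos hx),
      Set.image_id']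
  have hPpos : P ⊆ posOrthant n := Set.image_subset_iff.2 fun x hx =>
    coordRpow_mem_posOrthant (hpos hx)
  have hsub : coordRpow p '' interior P ⊆ K :=
    (Set.image_mono interior_subset).trans himage.subset
  refine ⟨interior P, isOpen_interior, hconv.interior, interior_subset.trans hPpos, hsub,
    hsub.eventuallyLE.antisymm (ae_le_set.2 ?_)⟩
  have hnull : volume (P \ interior P) = 0 :=
    measure_mono_null (Set.sdiff_subset_sdiff_left subset_closure) (hconv.addHaar_frontier volume)
  have hdiff : DifferentiableOn ℝ (coordRpow p) (P \ interior P) := fun y hy =>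
    (hasFDerivAt_coordRpow (hPpos hy.1)).differentiableAt.differentiableWithinAt
  refine measure_mono_null ?_
    (addHaar_image_eq_zero_of_differentiableOn_of_addHaar_eq_zero volume hdiff hnull)
  rintro x ⟨hxK, hx⟩
  obtain ⟨y, hy, rfl⟩ := himage.superset hxK
  exact Set.mem_image_of_mem _ ⟨hy, fun hyint => hx (Set.mem_image_of_mem _ hyint)⟩

theorem aemeasurable_partialDeriv (hV : IsOpen V) (hf : LocallyLipschitzOn V f) (i : Fin n) :
    AEMeasurable (partialDeriv i f) (volume.restrict V) := by
  refine ((measurable_fderiv_apply_const ℝ f (Pi.single i 1)).aemeasurable).congr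
    ((ae_restrict_iff' hV.measurableSet).2 ?_)
  filter_upwards [ae_differentiableAt_of_locallyLipschitzOn hV hf] with x hd hx
  exact (hd hx).lineDeriv_eq_fderiv.symm

theorem lintegral_sq_le_image_coordRpow (hp : 1 < p) (hV : IsOpen V) (hconv : Convex ℝ V)
    (hpos : V ⊆ posOrthant n) (hf : LocallyLipschitzOn (coordRpow p '' V) f)
    (hint : IntegrableOn f (coordRpow p '' V)) (hzero : ∫ x in coordRpow p '' V, f x = 0) :
    ∫⁻ x in coordRpow p '' V, ENNReal.ofReal (f x ^ 2) ≤
      ∫⁻ x in coordRpow p '' V, ENNReal.ofReal (p ^ 2 / (p - 1) * scaledGradSq id f x) := by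
  have hp₀ : 0 < p := one_pos.trans hp
  have hW : IsOpen (coordRpow p '' V) := isOpen_image_coordRpow hp₀.ne' hV hpos
  have hmap := map_coordRpow_weightedVolume hp₀ hV.measurableSet hpos
  have hdiff : ∀ᵐ y ∂weightedVolume (powerWeight p (p - 1)) V,
      y ∈ posOrthant n ∧ DifferentiableAt ℝ f (coordRpow p y) := by
    refine (ae_weightedVolume_of_ae hV.measurableSet (.of_forall hpos)).and
      (ae_of_ae_map measurable_coordRpow.aemeasurable ?_)
    rw [hmap, ae_restrict_iff' hW.measurableSet]
    exact ae_differentiableAt_of_locallyLipschitzOn hW hf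
  have hgrad : AEMeasurable (fun x => ENNReal.ofReal (p ^ 2 / (p - 1) * scaledGradSq id f x))
      (volume.restrict (coordRpow p '' V)) :=
    ((Finset.aemeasurable_fun_sum _ fun i _ => (((measurable_pi_apply i).aemeasurable.mul
      (aemeasurable_partialDeriv hW hf i)).pow_const 2)).const_mul _).ennreal_ofReal
  have hcomp : LocallyLipschitzOn V (f ∘ coordRpow p) := locallyLipschitzOn_comp hf
    (locallyLipschitz_coordRpow hp.le).locallyLipschitzOn (Set.mapsTo_image _ _)
  rw [IntegrableOn, ← hmap] at hint
  rw [← hmap] at hgrad hzero ⊢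
  rw [integral_map measurable_coordRpow.aemeasurable hint.1] at hzero
  calc _ ≤ ∫⁻ y, ENNReal.ofReal ((f ∘ coordRpow p) y ^ 2)
          ∂weightedVolume (powerWeight p (p - 1)) V :=
        lintegral_map_le (fun x => ENNReal.ofReal (f x ^ 2)) _
    _ ≤ ∫⁻ y, ENNReal.ofReal (scaledGradSq (fun z i => z i / √(p - 1)) (f ∘ coordRpow p) y)
          ∂weightedVolume (powerWeight p (p - 1)) V :=
        ((hasLogConcavityScale_powerWeight hp₀ (sub_pos.2 hp)).mono hpos).lintegral_sq_le hV hconv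
          hcomp (hint.comp_measurable measurable_coordRpow) hzero
    _ = ∫⁻ y, ENNReal.ofReal (p ^ 2 / (p - 1) * scaledGradSq id f (coordRpow p y))
          ∂weightedVolume (powerWeight p (p - 1)) V :=
        lintegral_congr_ae <| hdiff.mono fun y hy => congrArg ENNReal.ofReal
          (scaledGradSq_comp_coordRpow (sub_pos.2 hp).le hy.1 hy.2)
    _ = _ := (lintegral_map' hgrad measurable_coordRpow.aemeasurable).symm

theorem lintegral_const_mul_scaledGradSq_id (hV : IsOpen V) (hf : LocallyLipschitzOn V f) {c : ℝ}
    (hc : 0 ≤ c) : ∫⁻ x in V, ENNReal.ofReal (c * scaledGradSq id f x) =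
      ENNReal.ofReal c *
        ∑ i, ∫⁻ x in V, ENNReal.ofReal (x i ^ 2 * |partialDeriv i f x| ^ 2) := by
  have hmeas (i : Fin n) : AEMeasurable
      (fun x => ENNReal.ofReal (x i ^ 2 * |partialDeriv i f x| ^ 2)) (volume.restrict V) :=
    (((measurable_pi_apply i).pow_const 2).aemeasurable.mul
      ((aemeasurable_partialDeriv hV hf i).norm.pow_const 2)).ennreal_ofReal
  rw [← lintegral_finsetSum' _ fun i _ => hmeas i, ← lintegral_const_mul' _ _ ENNReal.ofReal_ne_top]
  refine lintegral_congr fun x => ?_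
  rw [← ENNReal.ofReal_sum_of_nonneg fun i _ => by positivity, ← ENNReal.ofReal_mul hc]
  simp only [scaledGradSq, id, mul_pow, sq_abs]

end PConvex

theorem corollary1p2_general {n : ℕ} {ℓ : ℝ} (hℓ : 1 < ℓ) {K : Set (Fin n → ℝ)}
    (hK : IsPConvex (1 / ℓ) K) {f : (Fin n → ℝ) → ℝ} (hLip : LocallyLipschitzOn K f)
    (hint : IntegrableOn f K) (hzero : ∫ x in K, f x = 0) :
    ∫⁻ x in K, ENNReal.ofReal (f x ^ 2) ≤
      ENNReal.ofReal (ℓ ^ 2 / (ℓ - 1)) *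
        ∑ i : Fin n, ∫⁻ x in K, ENNReal.ofReal (x i ^ 2 * |partialDeriv i f x| ^ 2) := by
  have hℓ₀ : ℓ ≠ 0 := (one_pos.trans hℓ).ne'
  obtain ⟨V, hV, hconv, hpos, hsub, hae⟩ :=
    (one_div ℓ ▸ hK).exists_isOpen_convex_image_ae_eq hℓ₀
  rw [IntegrableOn, ← Measure.restrict_congr_set hae] at hint
  rw [← Measure.restrict_congr_set hae] at hzero ⊢
  have hLip' := hLip.mono hsub
  rw [← lintegral_const_mul_scaledGradSq_id (isOpen_image_coordRpow hℓ₀ hV hpos) hLip'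
    (div_nonneg (sq_nonneg ℓ) (sub_pos.2 hℓ).le)]
  exact lintegral_sq_le_image_coordRpow hℓ hV hconv hpos hLip' hint hzero

theorem corollary1p2 (n ℓ : ℕ) (hn : 1 ≤ n) (hℓ : 1 < ℓ)
    (K : Set (Fin n → ℝ)) (hK : IsPConvex (1 / (ℓ : ℝ)) K) (hKint : (interior K).Nonempty)
    (f : (Fin n → ℝ) → ℝ) (hLip : LocallyLipschitzOn K f)
    (hint : IntegrableOn f K volume) (hzero : ∫ x in K, f x = 0) :
    ∫⁻ x in K, ENNReal.ofReal (f x ^ 2) ≤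
      ENNReal.ofReal ((ℓ : ℝ) ^ 2 / ((ℓ : ℝ) - 1)) *
        ∑ i : Fin n, ∫⁻ x in K, ENNReal.ofReal (x i ^ 2 * |partialDeriv i f x| ^ 2) :=
  corollary1p2_general (Nat.one_lt_cast.2 hℓ) hK hLip hint hzero
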